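/- Let $(X,T)$ be a topological dynamical system, i.e. $X$ is a compact metric space with metric $d$ and $T\colon X\to X$ is a homeomorphism. Let $\mu$ be a $T$-invariant Borel probability measure on $X$ (not necessarily ergodic) and let $n\ge 2$ be an integer. Write $\Delta_n(X)=\{(x,\dots,x):x\in X\}\subset X^n$ and $B(x,\tau)=\{y\in X: d(x,y)<\tau\}$. A tuple $(x_1,\dots,x_n)\in X^n\setminus\Delta_n(X)$ is called a *$\mu$-$n$-sensitive in the mean tuple* if for every $\tau>0$ there is $\delta>0$ such that for every Borel set $A\subset X$ with $\mu(A)>0$ there are an integer $m\ge 1$ and points $y_1,\dots,y_n\in A$ with $$\frac{\#\{0\le k\le m-1:\ T^k y_i\in B(x_i,\tau)\text{ for all } i=1,\dots,n\}}{m}>\delta .$$ Let $SM_n^\mu(X,T)$ be the set of all these tuples. For a finite Borel partition $\alpha$ of $X$ let $H_\mu(\alpha)=-\sum_{A\in\alpha}\mu(A)\log\mu(A)$ (with $0\log 0=0$), and for an infinite set $S=\{s_1<s_2<\cdots\}$ of positive integers let $$h_\mu^S(T,\alpha)=\limsup_{N\to\infty}\frac1N H_\mu\Big(\bigvee_{j=1}^{N}T^{-s_j}\alpha\Big).$$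 The partition $\alpha$ is *admissible* with respect to $(x_1,\dots,x_n)$ if for every $A\in\alpha$ there is an $i$ with $x_i\notin\overline{A}$. A tuple $(x_1,\dots,x_n)\in X^n\setminus\Delta_n(X)$ is called a *$\mu$-sequence entropy $n$-tuple* if for every finite Borel partition $\alpha$ of $X$ that is admissible with respect to $(x_1,\dots,x_n)$ there is an infinite set $S$ of positive integers with $h_\mu^S(T,\alpha)>0$. Let $SE_n^\mu(X,T)$ be the set of all these tuples. Then $$SM_n^\mu(X,T)\subset SE_n^\mu(X,T).$$ -/

import Mathlib

open MeasureTheory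

noncomputable section

namespace SeqEntropyTuples

/-- A finite Borel measurable partition of `X`, given as a family of cells indexed by a type `ι`
(used below only for finite `ι`). Empty cells are allowed: they do not affect entropy. -/
structure MeasurablePartition (X : Type*) [MeasurableSpace X] (ι : Type*) where
  cell : ι → Set X
  measurableSet_cell : ∀ a, MeasurableSet (cell a)
  disjoint_cell : ∀ a b, a ≠ b → Disjoint (cell a) (cell b)
  iUnion_cell : (⋃ a, cell a) = Set.univ

namespace MeasurablePartition

variable {X : Type*} [MeasurableSpace X] {ι κ : Type*}

/-- The pulled back partition `f⁻¹ α = {f⁻¹ A : A ∈ α}`. -/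
def preimage (α : MeasurablePartition X ι) (f : X → X) (hf : Measurable f) :
    MeasurablePartition X ι where
  cell a := f ⁻¹' α.cell a
  measurableSet_cell a := hf (α.measurableSet_cell a)
  disjoint_cell a b hab := (α.disjoint_cell a b hab).preimage f
  iUnion_cell := by
    rw [← Set.preimage_iUnion, α.iUnion_cell, Set.preimage_univ]

/-- The common refinement `⋁ j, α j` of a finite family of partitions: its cells are the
intersections `⋂ j, A j` with `A j` a cell of `α j`. -/
def join [Countable κ] (α : κ → MeasurablePartition X ι) : MeasurablePartition X (κ → ι) where
  cell ω := ⋂ j, (α j).cell (ω j)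
  measurableSet_cell ω := MeasurableSet.iInter fun j => (α j).measurableSet_cell (ω j)
  disjoint_cell ω η h := by
    obtain ⟨j, hj⟩ := Function.ne_iff.mp h
    exact ((α j).disjoint_cell _ _ hj).mono (Set.iInter_subset _ j) (Set.iInter_subset _ j)
  iUnion_cell := by
    refine Set.eq_univ_of_forall fun x => ?_
    have hx : ∀ j, ∃ a, x ∈ (α j).cell a := fun j =>
      Set.mem_iUnion.mp ((α j).iUnion_cell ▸ Set.mem_univ x)
    choose ω hω using hx
    exact Set.mem_iUnion.mpr ⟨ω, Set.mem_iInter.mpr hω⟩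

/-- The Shannon entropy `H_μ(α) = - ∑ A ∈ α, μ(A) log μ(A)`, with `0 log 0 = 0`. -/
def entropy [Fintype ι] (α : MeasurablePartition X ι) (μ : Measure X) : ℝ :=
  ∑ a, Real.negMulLog (μ.real (α.cell a))

/-- The sequence entropy `h_μ^S(T, α) = limsup_N (1/N) H_μ(⋁_{j < N} T^{-s j} α)` of `T` with
respect to the finite partition `α` along the sequence `S = (s 0, s 1, …)`. -/
def seqEntropy [Fintype ι] (α : MeasurablePartition X ι) (μ : Measure X)
    (T : X → X) (hT : Measurable T) (s : ℕ → ℕ) : EReal :=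
  Filter.limsup
    (fun N : ℕ =>
      (((join fun j : Fin N => α.preimage (T^[s j]) (hT.iterate (s j))).entropy μ / N : ℝ) : EReal))
    Filter.atTop

/-- A partition is admissible with respect to `(x 0, …, x (n-1))` if the closure of each of its
cells misses at least one of the points `x i`. -/
def Admissible [TopologicalSpace X] (α : MeasurablePartition X ι) {n : ℕ} (x : Fin n → X) : Prop :=
  ∀ a, ∃ i, x i ∉ closure (α.cell a)

end MeasurablePartition

/-- `Δ_n(X)`, the set of the `n`-tuples all of whose entries are equal. -/
def diagonal (X : Type*) (n : ℕ) : Set (Fin n → X) :=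
  {x | ∀ i j, x i = x j}

/-- `SM_n^μ(X, T)`, the set of `μ`-`n`-sensitive in the mean tuples. -/
def sensitiveInMeanTuples {X : Type*} [MetricSpace X] [MeasurableSpace X]
    (μ : Measure X) (T : X → X) (n : ℕ) : Set (Fin n → X) :=
  {x | x ∉ diagonal X n ∧
    ∀ τ : ℝ, 0 < τ → ∃ δ : ℝ, 0 < δ ∧
      ∀ A : Set X, MeasurableSet A → 0 < μ A →
        ∃ m : ℕ, 1 ≤ m ∧ ∃ y : Fin n → X, (∀ i, y i ∈ A) ∧
          δ < (Set.ncard {k : ℕ | k < m ∧ ∀ i, T^[k] (y i) ∈ Metric.ball (x i) τ} : ℝ) / m}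

/-- `SE_n^μ(X, T)`, the set of sequence entropy `n`-tuples for `μ`. An infinite set `S` of positive
integers is given by its increasing enumeration `s`. -/
def sequenceEntropyTuples {X : Type*} [TopologicalSpace X] [MeasurableSpace X]
    (μ : Measure X) (T : X → X) (hT : Measurable T) (n : ℕ) : Set (Fin n → X) :=
  {x | x ∉ diagonal X n ∧
    ∀ (l : ℕ) (α : MeasurablePartition X (Fin l)), α.Admissible x →
      ∃ s : ℕ → ℕ, StrictMono s ∧ (∀ j, 1 ≤ s j) ∧ 0 < α.seqEntropy μ T hT s}

end SeqEntropyTuples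

end

/-!
Let `α` be a partition admissible for a sensitive in the mean tuple `x`, let `f` give the cell of a
point, and suppose that no sequence gives `α` positive entropy. Two facts contradict each other.

*Zero sequence entropy makes the translates of `α` almost finite-dimensional.* Adding `T^{-k} α` to a
finite join `β` raises the entropy by at least the distance of `f ∘ T^[k]` from the `β`-measurable
functions (`sum_negMulLog_add_le_of_forall_ne`). If these distances did not all become small for
`β = ⋁ j < K, T^{-j} α` with `K` large, a greedy choice of times would give a sequence of positive
entropy (`exists_name_approx`). So, for some `K`, every `f ∘ T^[k]` is nearly constant on the cells
of `β`, up to a small set; then over any time span there is a cell `C` of `β` of positive measure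
such that the names of the pairs in `C × C` differ rarely on average (`exists_name_sum_error_le`,
`integral_mismatch_le`).

*Sensitivity makes the names of almost all pairs differ often.* If the orbits of `y 0, …, y (n - 1)`
are near the respective entries of `x` with frequency more than `δ`, then by admissibility the names
of some `y 0` and `y i` differ with frequency more than `δ / n` (`exists_lt_mismatch`). Hence the
balls of a small radius `ε` for the pseudometric "supremum over `m` of the frequency of differences
before time `m`" are null, and by Fubini almost every pair `(y, z)` has a time span over which the
names differ with frequency more than `ε` (`tendsto_measureReal_closePairs`). As in the proof of the
maximal ergodic theorem, covering long orbits of `T × T` by such time spans shows that the names of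
the pairs in `C × C` differ with average frequency at least `ε / 2` over long time spans, for each
of the finitely many cells `C` of positive measure (`le_sum_of_forall_window`,
`le_integral_mismatch`).

No ergodicity and no spectral theory of the Koopman operator is needed.
-/

open MeasureTheory Filter Topology

namespace SeqEntropyTuples

/-! ### A covering argument for averages along an orbit -/

/-- If from every time `k` that is not bad (`b k < 1`) some window of length at most `M` starts on
which `a` has average at least `ε`, then concatenating such windows and skipping the bad times
shows that the sum of `a` over any `N` consecutive times is at least `ε` times the number of good
times among them, up to the length `M` of one incomplete window. -/
theorem le_sum_of_forall_window {a b : ℕ → ℝ} (ha : ∀ k, 0 ≤ a k) (hb : ∀ k, 0 ≤ b k) {ε : ℝ}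
    (hε : 0 ≤ ε) {M : ℕ}
    (h : ∀ k, 1 ≤ b k ∨ ∃ m : ℕ, 1 ≤ m ∧ m ≤ M ∧ ε * m ≤ ∑ i ∈ Finset.range m, a (k + i))
    (N k : ℕ) :
    ε * (N - M - ∑ i ∈ Finset.range N, b (k + i)) ≤ ∑ i ∈ Finset.range N, a (k + i) := by
  induction N using Nat.strong_induction_on generalizing k with
  | _ N ih =>
    have hB : 0 ≤ ∑ i ∈ Finset.range N, b (k + i) := Finset.sum_nonneg fun i _ => hb _
    rcases le_or_gt N M with hNM | hMN
    · have hA : 0 ≤ ∑ i ∈ Finset.range N, a (k + i) := Finset.sum_nonneg fun i _ => ha _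
      have : (N : ℝ) ≤ M := by exact_mod_cast hNM
      nlinarith
    · -- Both cases peel off an initial block of length `m` on which the estimate holds.
      have key : ∃ m : ℕ, 1 ≤ m ∧ m ≤ N ∧
          ε * (m - ∑ i ∈ Finset.range m, b (k + i)) ≤ ∑ i ∈ Finset.range m, a (k + i) := by
        rcases h k with hk | ⟨m, hm1, hmM, hm⟩
        · refine ⟨1, le_rfl, by omega, ?_⟩
          have := ha k
          simp only [Finset.sum_range_one, add_zero, Nat.cast_one]
          nlinarith
        · refine ⟨m, hm1, by omega, ?_⟩
          have : 0 ≤ ∑ i ∈ Finset.range m, b (k + i) := Finset.sum_nonneg fun i _ => hb _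
          nlinarith
      obtain ⟨m, hm1, hmN, hm⟩ := key
      obtain ⟨r, rfl⟩ := Nat.exists_eq_add_of_le hmN
      have := ih r (by omega) (k + m)
      rw [Finset.sum_range_add, Finset.sum_range_add]
      push_cast
      simp only [add_assoc] at this ⊢
      nlinarith

/-! ### Entropy of finite-valued functions -/

section Entropy

variable {X : Type*} [MeasurableSpace X] {μ : Measure X}

/-- Shannon's inequality for one cell: refining a cell of mass `∑ j, m j` into cells of masses
`m j ≤ B` raises the entropy by at least the mass outside a cell of mass `B`. -/
theorem negMulLog_sum_add_le {κ : Type*} [Fintype κ] [Nonempty κ] (m : κ → ℝ) (hm : ∀ j, 0 ≤ m j) {B : ℝ}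
    (hB : ∀ j, m j ≤ B) :
    Real.negMulLog (∑ j, m j) + (∑ j, m j - B) ≤ ∑ j, Real.negMulLog (m j) := by
  set S := ∑ j, m j with hS
  have hS0 : 0 ≤ S := Finset.sum_nonneg fun j _ => hm j
  rcases hS0.eq_or_lt with h0 | hpos
  · have hz : ∀ j, m j = 0 := fun j =>
      (Finset.sum_eq_zero_iff_of_nonneg fun j _ => hm j).1 h0.symm j (Finset.mem_univ j)
    rw [← h0]
    simp only [hz, Real.negMulLog_zero, Finset.sum_const_zero]
    have := (hm (Classical.arbitrary κ)).trans (hB _)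
    linarith
  · have key : ∀ j, m j * (-Real.log S + (1 - B / S)) ≤ Real.negMulLog (m j) := by
      intro j
      rcases (hm j).eq_or_lt with hj | hj
      · simp [← hj]
      · have h1 : Real.log (m j / S) ≤ m j / S - 1 := Real.log_le_sub_one_of_pos (by positivity)
        rw [Real.log_div hj.ne' hpos.ne'] at h1
        have h2 : m j / S ≤ B / S := by gcongr; exact hB j
        rw [Real.negMulLog]
        nlinarith
    calc Real.negMulLog S + (S - B) = ∑ j, m j * (-Real.log S + (1 - B / S)) := by
          rw [← Finset.sum_mul, ← hS, Real.negMulLog]; field_simp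
      _ ≤ _ := Finset.sum_le_sum fun j _ => key j

/-- If no function of `p` agrees with `q` outside a set of measure less than `c`, then passing from
the partition into level sets of `p` to that of `(p, q)` raises the entropy by at least `c`. -/
theorem sum_negMulLog_add_le_of_forall_ne {ι κ : Type*} [Fintype ι] [Fintype κ] [Nonempty κ]
    [MeasurableSpace ι] [DiscreteMeasurableSpace ι] [MeasurableSpace κ] [DiscreteMeasurableSpace κ]
    [IsFiniteMeasure μ] {p : X → ι} {q : X → κ} (hp : Measurable p) (hq : Measurable q) {c : ℝ}
    (h : ∀ g : ι → κ, c ≤ μ.real {x | q x ≠ g (p x)}) :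
    ∑ i, Real.negMulLog (μ.real (p ⁻¹' {i})) + c ≤
      ∑ z : ι × κ, Real.negMulLog (μ.real (p ⁻¹' {z.1} ∩ q ⁻¹' {z.2})) := by
  have hmax : ∀ i, ∃ j, ∀ j', μ.real (p ⁻¹' {i} ∩ q ⁻¹' {j'}) ≤ μ.real (p ⁻¹' {i} ∩ q ⁻¹' {j}) :=
    fun i => Finite.exists_max fun j' => μ.real (p ⁻¹' {i} ∩ q ⁻¹' {j'})
  choose g hg using hmax
  have hpm : ∀ i, MeasurableSet (p ⁻¹' {i}) := fun i => hp (measurableSet_singleton i)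
  have hqm : ∀ j, MeasurableSet (q ⁻¹' {j}) := fun j => hq (measurableSet_singleton j)
  have hsum : ∀ i, ∑ j, μ.real (p ⁻¹' {i} ∩ q ⁻¹' {j}) = μ.real (p ⁻¹' {i}) := by
    intro i
    rw [← measureReal_iUnion_fintype]
    · congr 1
      ext x
      simp
    · intro j j' hjj'
      refine Set.disjoint_left.2 fun x hx hx' => hjj' ?_
      exact hx.2.symm.trans hx'.2
    · exact fun j => (hpm i).inter (hqm j)
  have hne : μ.real {x | q x ≠ g (p x)} ≤
      ∑ i, (μ.real (p ⁻¹' {i}) - μ.real (p ⁻¹' {i} ∩ q ⁻¹' {g i})) := by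
    have hsub : {x | q x ≠ g (p x)} ⊆ ⋃ i, p ⁻¹' {i} \ (p ⁻¹' {i} ∩ q ⁻¹' {g i}) := by
      intro x hx
      exact Set.mem_iUnion.2 ⟨p x, rfl, fun hx' => hx hx'.2⟩
    refine (measureReal_mono hsub).trans ((measureReal_iUnion_fintype_le _).trans ?_)
    refine Finset.sum_le_sum fun i _ => ?_
    rw [measureReal_sdiff Set.inter_subset_left ((hpm i).inter (hqm _))]
  have hcell := fun i => negMulLog_sum_add_le (fun j => μ.real (p ⁻¹' {i} ∩ q ⁻¹' {j}))
    (fun j => measureReal_nonneg) (hg i)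
  simp only [hsum] at hcell
  rw [Fintype.sum_prod_type]
  have := Finset.sum_le_sum fun i (_ : i ∈ Finset.univ) => hcell i
  rw [Finset.sum_add_distrib] at this
  linarith [h g]

end Entropy

/-! ### The name of a point -/

section Names

variable {X : Type*} {l : ℕ}

/-- The name of `x` along the times `s 0, …, s (N - 1)`: the values there of the `Fin l`-valued
function `f` along the orbit of `x`. Its level sets are the cells of `⋁ j < N, T^{-s j} α`, where
`α` is the partition into level sets of `f`. -/
def name (f : X → Fin l) (T : X → X) (s : ℕ → ℕ) (N : ℕ) (x : X) : Fin N → Fin l :=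
  fun j => f (T^[s j] x)

theorem measurable_name [MeasurableSpace X] {f : X → Fin l} {T : X → X} (hf : Measurable f)
    (hT : Measurable T) (s : ℕ → ℕ) (N : ℕ) : Measurable (name f T s N) :=
  measurable_pi_lambda _ fun _ => hf.comp (hT.iterate _)

theorem measurableSet_ne_comp_name [MeasurableSpace X] {f : X → Fin l} {T : X → X}
    (hf : Measurable f) (hT : Measurable T) (s : ℕ → ℕ) (N k : ℕ)
    (g : (Fin N → Fin l) → Fin l) : MeasurableSet {x | f (T^[k] x) ≠ g (name f T s N x)} :=
  (measurableSet_eq_fun (hf.comp (hT.iterate k))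
    ((measurable_of_finite g).comp (measurable_name hf hT s N))).compl

/-- A partition consists of the level sets of the function that assigns to a point the index of its
cell. -/
theorem MeasurablePartition.exists_measurable_cell_eq [MeasurableSpace X]
    (α : MeasurablePartition X (Fin l)) :
    ∃ f : X → Fin l, Measurable f ∧ ∀ a, α.cell a = f ⁻¹' {a} := by
  have hx : ∀ x, ∃ a, x ∈ α.cell a := fun x =>
    Set.mem_iUnion.mp (α.iUnion_cell ▸ Set.mem_univ x)
  choose f hf using hx
  have hcell : ∀ a, α.cell a = f ⁻¹' {a} := by
    intro a
    ext x
    refine ⟨fun hxa => ?_, fun hxa => hxa ▸ hf x⟩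
    by_contra hne
    exact Set.disjoint_left.1 (α.disjoint_cell _ _ hne) (hf x) hxa
  exact ⟨f, measurable_to_countable' fun a => hcell a ▸ α.measurableSet_cell a, hcell⟩

theorem entropy_join_eq [MeasurableSpace X] {μ : Measure X} {α : MeasurablePartition X (Fin l)}
    {f : X → Fin l} (hα : ∀ a, α.cell a = f ⁻¹' {a}) {T : X → X} (hT : Measurable T)
    (s : ℕ → ℕ) (N : ℕ) :
    (MeasurablePartition.join fun j : Fin N =>
      α.preimage (T^[s j]) (hT.iterate (s j))).entropy μ =
      ∑ ω, Real.negMulLog (μ.real (name f T s N ⁻¹' {ω})) := by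
  refine Finset.sum_congr rfl fun ω _ => ?_
  congr 2
  ext x
  simp [MeasurablePartition.join, MeasurablePartition.preimage, hα, name, funext_iff]

theorem preimage_name_snoc (f : X → Fin l) (T : X → X) (s : ℕ → ℕ) (N : ℕ) (ω : Fin N → Fin l)
    (a : Fin l) :
    name f T s (N + 1) ⁻¹' {Fin.snoc ω a} =
      name f T s N ⁻¹' {ω} ∩ (fun x => f (T^[s N] x)) ⁻¹' {a} := by
  ext x
  simp [name, funext_iff, Fin.forall_fin_succ']

theorem sum_name_succ {N : ℕ} (F : (Fin (N + 1) → Fin l) → ℝ) :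
    ∑ ω, F ω = ∑ z : (Fin N → Fin l) × Fin l, F (Fin.snoc z.1 z.2) := by
  rw [← (Fin.snocEquiv fun _ : Fin (N + 1) => Fin l).sum_comp,
    ← (Equiv.prodComm _ _).sum_comp]
  rfl

/-- If each new time `s N` has `f ∘ T^[s N]` at distance at least `c` from every function of the
preceding names, then the sequence entropy along `s` is at least `c`. -/
theorem le_seqEntropy [MeasurableSpace X] {μ : Measure X} [IsProbabilityMeasure μ]
    {α : MeasurablePartition X (Fin l)} {f : X → Fin l} (hf : Measurable f)
    (hα : ∀ a, α.cell a = f ⁻¹' {a}) {T : X → X} (hT : Measurable T) {s : ℕ → ℕ} {c : ℝ}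
    (h : ∀ N, ∀ g : (Fin N → Fin l) → Fin l, c ≤ μ.real {x | f (T^[s N] x) ≠ g (name f T s N x)}) :
    (c : EReal) ≤ α.seqEntropy μ T hT s := by
  have : Nonempty X := nonempty_of_isProbabilityMeasure μ
  have : Nonempty (Fin l) := this.map f
  have hH : ∀ N : ℕ, c * N ≤ (MeasurablePartition.join fun j : Fin N =>
      α.preimage (T^[s j]) (hT.iterate (s j))).entropy μ := by
    intro N
    rw [entropy_join_eq hα hT]
    induction N with
    | zero =>
      simp only [Nat.cast_zero, mul_zero]
      exact Finset.sum_nonneg fun ω _ => Real.negMulLog_nonneg measureReal_nonneg measureReal_le_one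
    | succ N ih =>
      have := sum_negMulLog_add_le_of_forall_ne (measurable_name hf hT s N)
        (hf.comp (hT.iterate (s N))) (h N)
      rw [sum_name_succ]
      simp only [preimage_name_snoc]
      push_cast
      simp only [Function.comp_def] at this
      linarith
  refine le_limsup_of_frequently_le (Eventually.frequently ?_) (by isBoundedDefault)
  filter_upwards [eventually_gt_atTop 0] with N hN
  have hN' : (0 : ℝ) < N := by exact_mod_cast hN
  exact_mod_cast (le_div_iff₀ hN').2 (hH N)

/-- If `α` has no positive sequence entropy, its translates are almost finite-dimensional: for
every `c` there is a `K` such that each `f ∘ T^[k]` is, up to measure `c`, a function of the name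
along `0, …, K - 1`. Otherwise a sequence of positive entropy can be chosen greedily. -/
theorem exists_name_approx [MeasurableSpace X] {μ : Measure X} [IsProbabilityMeasure μ]
    {α : MeasurablePartition X (Fin l)} {f : X → Fin l} (hf : Measurable f)
    (hα : ∀ a, α.cell a = f ⁻¹' {a}) {T : X → X} (hT : Measurable T)
    (h : ¬ ∃ s : ℕ → ℕ, StrictMono s ∧ (∀ j, 1 ≤ s j) ∧ 0 < α.seqEntropy μ T hT s)
    {c : ℝ} (hc : 0 < c) :
    ∃ K : ℕ, ∀ k, ∃ g : (Fin K → Fin l) → Fin l,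
      μ.real {x | f (T^[k] x) ≠ g (name f T id K x)} < c := by
  by_contra! hcon
  choose t ht using hcon
  -- A time `k < K` is read off from the name, so the time missed by all functions of it is later.
  have htK : ∀ K, K ≤ t K := by
    intro K
    by_contra! hlt
    have := ht K fun ω => ω ⟨t K, hlt⟩
    simp [name] at this
    linarith
  let s : ℕ → ℕ := fun N => Nat.rec (t 1) (fun _ r => t (r + 1)) N
  have hs : StrictMono s := strictMono_nat_of_lt_succ fun N => htK (s N + 1)
  refine h ⟨s, hs, fun j => (htK 1).trans (hs.monotone (Nat.zero_le j)), ?_⟩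
  refine lt_of_lt_of_le (by exact_mod_cast hc) (le_seqEntropy hf hα hT (c := c) fun N g => ?_)
  obtain ⟨K, hK, hlt⟩ : ∃ K, s N = t K ∧ ∀ j < N, s j < K := by
    cases N with
    | zero => exact ⟨1, rfl, by simp⟩
    | succ N => exact ⟨s N + 1, rfl, fun j hj =>
        Nat.lt_succ_of_le (hs.monotone (Nat.le_of_lt_succ hj))⟩
  rw [hK]
  exact ht K fun ω => g fun j => ω ⟨s j, hlt j j.2⟩

end Names

/-! ### Mean distance of names and sensitivity -/

section Sensitivity

variable {X : Type*} {l : ℕ}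

/-- The number of times `k < m` at which the orbits of `y` and `z` are in different level sets of
`f`, as a real number. -/
def mismatch (f : X → Fin l) (T : X → X) (m : ℕ) (y z : X) : ℝ :=
  ∑ k ∈ Finset.range m, if f (T^[k] y) = f (T^[k] z) then 0 else 1

theorem mismatch_comm (f : X → Fin l) (T : X → X) (m : ℕ) (y z : X) :
    mismatch f T m y z = mismatch f T m z y := by
  simp only [mismatch, eq_comm]

theorem mismatch_triangle (f : X → Fin l) (T : X → X) (m : ℕ) (x y z : X) :
    mismatch f T m x z ≤ mismatch f T m x y + mismatch f T m y z := by
  rw [mismatch, mismatch, mismatch, ← Finset.sum_add_distrib]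
  refine Finset.sum_le_sum fun k _ => ?_
  split_ifs <;> first | (norm_num; done) | simp_all

theorem measurable_mismatch [MeasurableSpace X] {f : X → Fin l} {T : X → X} (hf : Measurable f)
    (hT : Measurable T) (m : ℕ) : Measurable fun w : X × X => mismatch f T m w.1 w.2 := by
  refine Finset.measurable_fun_sum _ fun k _ => Measurable.ite ?_ measurable_const measurable_const
  exact measurableSet_eq_fun ((hf.comp (hT.iterate k)).comp measurable_fst)
    ((hf.comp (hT.iterate k)).comp measurable_snd)

/-- The pairs whose names stay `ε`-close in the mean over all time spans up to `M`. -/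
def closePairs (f : X → Fin l) (T : X → X) (ε : ℝ) (M : ℕ) : Set (X × X) :=
  {w | ∀ m : ℕ, 1 ≤ m → m ≤ M → mismatch f T m w.1 w.2 ≤ ε * m}

theorem measurableSet_closePairs [MeasurableSpace X] {f : X → Fin l} {T : X → X}
    (hf : Measurable f) (hT : Measurable T) (ε : ℝ) (M : ℕ) :
    MeasurableSet (closePairs f T ε M) := by
  simp only [closePairs, Set.ofPred_forall]
  exact MeasurableSet.iInter fun m => MeasurableSet.iInter fun _ => MeasurableSet.iInter fun _ =>
    measurableSet_le (measurable_mismatch hf hT m) measurable_const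

/-- If every set of positive measure contains two points whose names differ with frequency more
than `2 * ε` over some time span, then almost no pair is `ε`-close over all time spans: the
supremum of the mean distances is a pseudometric, all of whose closed balls of radius `ε` are null. -/
theorem tendsto_measureReal_closePairs [MeasurableSpace X] {μ : Measure X} [IsProbabilityMeasure μ]
    {f : X → Fin l} {T : X → X} (hf : Measurable f) (hT : Measurable T) {ε : ℝ}
    (h : ∀ A : Set X, MeasurableSet A → 0 < μ A →
      ∃ m : ℕ, 1 ≤ m ∧ ∃ y ∈ A, ∃ z ∈ A, 2 * ε * m < mismatch f T m y z) :
    Tendsto (fun M => (μ.prod μ).real (closePairs f T ε M)) atTop (𝓝 0) := by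
  have hmeas := measurableSet_closePairs hf hT ε
  have hinter : MeasurableSet (⋂ M, closePairs f T ε M) := MeasurableSet.iInter hmeas
  have hnull : (μ.prod μ) (⋂ M, closePairs f T ε M) = 0 := by
    rw [Measure.measure_prod_null hinter]
    refine Eventually.of_forall fun x => ?_
    by_contra hne
    obtain ⟨m, hm, y, hy, z, hz, hyz⟩ :=
      h _ (measurable_prodMk_left hinter) (pos_iff_ne_zero.2 hne)
    have h1 := Set.mem_iInter.1 hy m m hm le_rfl
    have h2 := Set.mem_iInter.1 hz m m hm le_rfl
    have h3 := mismatch_triangle f T m y x z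
    rw [mismatch_comm f T m y x] at h3
    simp only at h1 h2
    linarith
  have hlim := tendsto_measure_iInter_atTop (μ := μ.prod μ)
    (fun M => (hmeas M).nullMeasurableSet)
    (fun M M' hMM' w hw m hm hmM => hw m hm (hmM.trans hMM')) ⟨0, measure_ne_top _ _⟩
  rw [hnull] at hlim
  simpa [Measure.real, Function.comp_def] using (ENNReal.tendsto_toReal ENNReal.zero_ne_top).comp hlim

/-- The total mismatch over `N` steps of the pairs in `C ×ˢ C` is large if few pairs are close. -/
theorem le_integral_mismatch [MeasurableSpace X] {μ : Measure X} [IsProbabilityMeasure μ]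
    {f : X → Fin l} {T : X → X} (hf : Measurable f) (hT : MeasurePreserving T μ μ) {ε : ℝ}
    (hε : 0 ≤ ε) (M N : ℕ) {C : Set X} :
    ε * ((N - M) * μ.real C ^ 2 - N * (μ.prod μ).real (closePairs f T ε M)) ≤
      ∫ w in C ×ˢ C, mismatch f T N w.1 w.2 ∂μ.prod μ := by
  have hS := hT.prod hT
  have hB := measurableSet_closePairs hf hT.measurable ε M
  set B := closePairs f T ε M with hBdef
  set b : X × X → ℝ := B.indicator 1 with hb
  have hbm : Measurable b := measurable_one.indicator hB
  have hbi : ∀ k, Integrable (fun w => b ((Prod.map T T)^[k] w)) (μ.prod μ) := by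
    intro k
    refine Integrable.of_bound (C := 1)
      (hbm.comp (hS.measurable.iterate k)).aestronglyMeasurable (Eventually.of_forall fun w => ?_)
    simp only [hb, Set.indicator]
    split_ifs <;> simp
  have hpt : ∀ w : X × X, ε * (N - M - ∑ k ∈ Finset.range N, b ((Prod.map T T)^[k] w)) ≤
      mismatch f T N w.1 w.2 := by
    rintro ⟨y, z⟩
    have := le_sum_of_forall_window
      (a := fun k => if f (T^[k] y) = f (T^[k] z) then 0 else 1)
      (b := fun k => b ((Prod.map T T)^[k] (y, z))) (M := M)
      (fun k => by split_ifs <;> norm_num)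
      (fun k => Set.indicator_nonneg (fun _ _ => zero_le_one) _) hε ?_ N 0
    · simpa [mismatch] using this
    · intro k
      by_cases hk : (Prod.map T T)^[k] (y, z) ∈ B
      · exact Or.inl (Set.indicator_of_mem hk 1).ge
      · right
        simp only [hBdef, closePairs, Set.mem_ofPred_eq, not_forall, not_le, Prod.map_iterate,
          Prod.map_apply, exists_prop, mismatch, ← Function.iterate_add_apply] at hk
        obtain ⟨m, hm1, hmM, hm⟩ := hk
        refine ⟨m, hm1, hmM, hm.le.trans_eq (Finset.sum_congr rfl fun i _ => ?_)⟩
        rw [add_comm k i]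
  have hmi : Integrable (fun w : X × X => mismatch f T N w.1 w.2) (μ.prod μ) := by
    refine Integrable.of_bound (C := N)
      (measurable_mismatch hf hT.measurable N).aestronglyMeasurable (Eventually.of_forall fun w => ?_)
    rw [Real.norm_eq_abs, mismatch]
    refine (Finset.abs_sum_le_sum_abs _ _).trans ?_
    refine (Finset.sum_le_card_nsmul _ _ 1 fun k _ => ?_).trans (by simp)
    split_ifs <;> norm_num
  have hsi := integrable_finsetSum (Finset.range N) fun k _ => hbi k
  have hint : ∀ k, ∫ w in C ×ˢ C, b ((Prod.map T T)^[k] w) ∂μ.prod μ ≤ (μ.prod μ).real B := by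
    intro k
    calc ∫ w in C ×ˢ C, b ((Prod.map T T)^[k] w) ∂μ.prod μ
        ≤ ∫ w, b ((Prod.map T T)^[k] w) ∂μ.prod μ :=
          setIntegral_le_integral (hbi k) (Eventually.of_forall fun w =>
            Set.indicator_nonneg (fun _ _ => zero_le_one) _)
      _ = ∫ w, b w ∂μ.prod μ := by
          have hk := hS.iterate k
          conv_rhs => rw [← hk.map_eq]
          rw [integral_map hk.measurable.aemeasurable hbm.aestronglyMeasurable]
      _ = (μ.prod μ).real B := integral_indicator_one hB
  refine le_trans ?_ (integral_mono (((integrable_const ((N : ℝ) - M)).sub hsi).const_mul ε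
    |>.integrableOn (s := C ×ˢ C)) hmi.integrableOn hpt)
  simp only [Pi.sub_apply]
  rw [integral_const_mul, integral_sub (integrable_const _) hsi.integrableOn,
    integral_finsetSum _ fun k _ => (hbi k).integrableOn]
  have hsum : ∑ k ∈ Finset.range N, ∫ w in C ×ˢ C, b ((Prod.map T T)^[k] w) ∂μ.prod μ ≤
      N * (μ.prod μ).real B :=
    (Finset.sum_le_sum fun k _ => hint k).trans_eq (by simp)
  have hconst : ∫ _ in C ×ˢ C, ((N : ℝ) - M) ∂μ.prod μ = (N - M) * μ.real C ^ 2 := by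
    rw [setIntegral_const, measureReal_prod_prod, smul_eq_mul]
    ring
  rw [hconst]
  gcongr

/-- The total mismatch of the pairs in a cell `C` of a partition by names is small if on `C` the
functions `f ∘ T^[k]` mostly agree with functions that are constant on `C`. -/
theorem integral_mismatch_le [MeasurableSpace X] {μ : Measure X} [IsProbabilityMeasure μ]
    {f : X → Fin l} {T : X → X} (hf : Measurable f) (hT : Measurable T) (N : ℕ) (C : Set X) (v : ℕ → Fin l) :
    ∫ w in C ×ˢ C, mismatch f T N w.1 w.2 ∂μ.prod μ ≤
      2 * μ.real C * ∑ k ∈ Finset.range N, μ.real (C ∩ {x | f (T^[k] x) ≠ v k}) := by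
  have hD : ∀ k, MeasurableSet {w : X × X | f (T^[k] w.1) ≠ f (T^[k] w.2)} := fun k =>
    (measurableSet_eq_fun ((hf.comp (hT.iterate k)).comp measurable_fst)
      ((hf.comp (hT.iterate k)).comp measurable_snd)).compl
  have heq : ∀ k, (fun w : X × X => if f (T^[k] w.1) = f (T^[k] w.2) then (0 : ℝ) else 1) =
      {w : X × X | f (T^[k] w.1) ≠ f (T^[k] w.2)}.indicator 1 := by
    intro k
    ext w
    by_cases h : f (T^[k] w.1) = f (T^[k] w.2) <;> simp [h]
  simp only [mismatch]
  rw [integral_finsetSum, Finset.mul_sum]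
  · refine Finset.sum_le_sum fun k _ => ?_
    rw [heq, integral_indicator_one (hD k), measureReal_restrict_apply (hD k)]
    have hsub : {w : X × X | f (T^[k] w.1) ≠ f (T^[k] w.2)} ∩ C ×ˢ C ⊆
        (C ∩ {x | f (T^[k] x) ≠ v k}) ×ˢ C ∪ C ×ˢ (C ∩ {x | f (T^[k] x) ≠ v k}) := by
      rintro ⟨y, z⟩ ⟨hne, hy, hz⟩
      by_cases hyv : f (T^[k] y) = v k
      · exact Or.inr ⟨hy, hz, fun hzv => hne (hyv.trans hzv.symm)⟩
      · exact Or.inl ⟨⟨hy, hyv⟩, hz⟩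
    refine (measureReal_mono hsub).trans ((measureReal_union_le _ _).trans_eq ?_)
    rw [measureReal_prod_prod, measureReal_prod_prod]
    ring
  · intro k _
    rw [heq]
    exact (integrable_indicator_iff (hD k)).2 (integrable_const _).integrableOn

/-- If each `f ∘ T^[k]` is nearly a function of the names of length `K`, then some name is typical
over `N` steps: on its cell `C` the errors have total measure at most `N * c * μ C`. -/
theorem exists_name_sum_error_le [MeasurableSpace X] {μ : Measure X} [IsProbabilityMeasure μ]
    {f : X → Fin l} {T : X → X} (hf : Measurable f) (hT : Measurable T) {c : ℝ} {K : ℕ}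
    {g : ℕ → (Fin K → Fin l) → Fin l}
    (hg : ∀ k, μ.real {x | f (T^[k] x) ≠ g k (name f T id K x)} < c) (N : ℕ) :
    ∃ ω, 0 < μ.real (name f T id K ⁻¹' {ω}) ∧
      ∑ k ∈ Finset.range N, μ.real (name f T id K ⁻¹' {ω} ∩ {x | f (T^[k] x) ≠ g k ω}) ≤
        N * c * μ.real (name f T id K ⁻¹' {ω}) := by
  set p := name f T id K with hp
  have hpm : ∀ ω, MeasurableSet (p ⁻¹' {ω}) := fun ω =>
    measurable_name hf hT id K (measurableSet_singleton ω)
  have hcells : ∀ E : Set X, MeasurableSet E → ∑ ω, μ.real (p ⁻¹' {ω} ∩ E) = μ.real E := by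
    intro E hE
    rw [← measureReal_iUnion_fintype]
    · congr 1
      ext x
      simp
    · intro ω ω' hne
      exact Set.disjoint_left.2 fun x hx hx' => hne (hx.1.symm.trans hx'.1)
    · exact fun ω => (hpm ω).inter hE
  have hone : ∑ ω, μ.real (p ⁻¹' {ω}) = 1 := by
    simpa using hcells Set.univ MeasurableSet.univ
  by_contra! hcon
  have hset : ∀ k ω, p ⁻¹' {ω} ∩ {x | f (T^[k] x) ≠ g k ω} =
      p ⁻¹' {ω} ∩ {x | f (T^[k] x) ≠ g k (p x)} := by
    intro k ω
    ext x
    refine and_congr_right fun hx => ?_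
    rw [Set.mem_ofPred_eq, Set.mem_ofPred_eq, show p x = ω from hx]
  have hlt : ∑ ω, N * c * μ.real (p ⁻¹' {ω}) <
      ∑ ω, ∑ k ∈ Finset.range N, μ.real (p ⁻¹' {ω} ∩ {x | f (T^[k] x) ≠ g k ω}) := by
    refine Finset.sum_lt_sum (fun ω _ => ?_) ?_
    · rcases (measureReal_nonneg (μ := μ) (s := p ⁻¹' {ω})).eq_or_lt with h0 | hpos
      · rw [← h0, mul_zero]
        exact Finset.sum_nonneg fun k _ => measureReal_nonneg
      · exact (hcon ω hpos).le
    · by_contra! hle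
      have hzero : ∀ ω ∈ Finset.univ, μ.real (p ⁻¹' {ω}) ≤ 0 := fun ω hω => by
        by_contra! hpos
        exact (hle ω hω).not_gt (hcon ω hpos)
      linarith [Finset.sum_nonpos hzero]
  rw [← Finset.mul_sum, hone, Finset.sum_comm] at hlt
  have hE : ∀ k, ∑ ω, μ.real (p ⁻¹' {ω} ∩ {x | f (T^[k] x) ≠ g k (p x)}) =
      μ.real {x | f (T^[k] x) ≠ g k (p x)} := fun k =>
    hcells _ (measurableSet_ne_comp_name hf hT id K k (g k))
  simp only [hset, hE] at hlt
  have : ∑ k ∈ Finset.range N, μ.real {x | f (T^[k] x) ≠ g k (p x)} ≤ N * c :=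
    (Finset.sum_le_sum fun k _ => (hg k).le).trans_eq (by simp)
  linarith

/-- Names that separate in the mean on every set of positive measure force a positive sequence
entropy. -/
theorem exists_seqEntropy_pos [MeasurableSpace X] {μ : Measure X} [IsProbabilityMeasure μ]
    {α : MeasurablePartition X (Fin l)} {f : X → Fin l} (hf : Measurable f)
    (hα : ∀ a, α.cell a = f ⁻¹' {a}) {T : X → X} (hT : MeasurePreserving T μ μ)
    {ε : ℝ} (hε : 0 < ε)
    (h : ∀ A : Set X, MeasurableSet A → 0 < μ A →
      ∃ m : ℕ, 1 ≤ m ∧ ∃ y ∈ A, ∃ z ∈ A, 2 * ε * m < mismatch f T m y z) :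
    ∃ s : ℕ → ℕ, StrictMono s ∧ (∀ j, 1 ≤ s j) ∧ 0 < α.seqEntropy μ T hT.measurable s := by
  by_contra hcon
  obtain ⟨K, hK⟩ := exists_name_approx hf hα hT.measurable hcon (c := ε / 8) (by positivity)
  choose g hg using hK
  have hev : ∀ᶠ M : ℕ in atTop, ∀ ω, 0 < μ.real (name f T id K ⁻¹' {ω}) →
      (μ.prod μ).real (closePairs f T ε M) < μ.real (name f T id K ⁻¹' {ω}) ^ 2 / 4 := by
    refine eventually_all.2 fun ω => ?_
    by_cases hω : 0 < μ.real (name f T id K ⁻¹' {ω})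
    · filter_upwards [(tendsto_measureReal_closePairs hf hT.measurable h).eventually
        (gt_mem_nhds (show 0 < μ.real (name f T id K ⁻¹' {ω}) ^ 2 / 4 by positivity))]
        with M hM _ using hM
    · exact Eventually.of_forall fun M hω' => absurd hω' hω
  obtain ⟨M, hM, hM1⟩ := (hev.and (eventually_gt_atTop 0)).exists
  -- Over `4 * M` steps the incomplete window and the close pairs each cost at most a quarter of the
  -- mass of `C ×ˢ C`, so the mean mismatch there is at least `ε / 2`, while the approximation within
  -- `ε / 8` bounds it by `ε / 4`.
  obtain ⟨ω, hω, herr⟩ := exists_name_sum_error_le hf hT.measurable hg (4 * M)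
  have hlow := le_integral_mismatch hf hT hε.le M (4 * M) (C := name f T id K ⁻¹' {ω})
  have hupp := integral_mismatch_le (μ := μ) hf hT.measurable (4 * M) (name f T id K ⁻¹' {ω})
    fun k => g k ω
  have hclose := hM ω hω
  set r := μ.real (name f T id K ⁻¹' {ω})
  have hM0 : (0 : ℝ) < M := by exact_mod_cast hM1
  push_cast at *
  have h1 := hlow.trans (hupp.trans (mul_le_mul_of_nonneg_left herr (by positivity)))
  have h2 : ε * (2 * M * r ^ 2) ≤
      ε * ((4 * M - M) * r ^ 2 - 4 * M * (μ.prod μ).real (closePairs f T ε M)) := by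
    gcongr
    nlinarith
  have h3 : 0 < ε * M * r ^ 2 := by positivity
  nlinarith

/-- At a time when the orbits of `y 0, …, y (n - 1)` are near the respective entries of a tuple for
which `α` is admissible, some `y i` is in another cell than `y 0`, so the frequency of such times
bounds the mean distance of one of these pairs of names from below. -/
theorem exists_lt_mismatch [MetricSpace X] [MeasurableSpace X] {α : MeasurablePartition X (Fin l)}
    {f : X → Fin l} (hα : ∀ a, α.cell a = f ⁻¹' {a}) {T : X → X} {n : ℕ} (hn : 0 < n)
    {x : Fin n → X} {τ : ℝ} (hτ : ∀ a, ∃ i, Disjoint (Metric.ball (x i) τ) (α.cell a))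
    {m : ℕ} (hm : 1 ≤ m) {y : Fin n → X} {δ : ℝ}
    (h : δ < (Set.ncard {k : ℕ | k < m ∧ ∀ i, T^[k] (y i) ∈ Metric.ball (x i) τ} : ℝ) / m) :
    ∃ i, δ / n * m < mismatch f T m (y ⟨0, hn⟩) (y i) := by
  classical
  have hm0 : (0 : ℝ) < m := by exact_mod_cast hm
  have hn0 : (0 : ℝ) < n := by exact_mod_cast hn
  have hcount : (Set.ncard {k : ℕ | k < m ∧ ∀ i, T^[k] (y i) ∈ Metric.ball (x i) τ} : ℝ) ≤
      ∑ i, mismatch f T m (y ⟨0, hn⟩) (y i) := by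
    have hfin : {k : ℕ | k < m ∧ ∀ i, T^[k] (y i) ∈ Metric.ball (x i) τ} =
        ((Finset.range m).filter fun k => ∀ i, T^[k] (y i) ∈ Metric.ball (x i) τ : Finset ℕ) := by
      ext k
      simp
    rw [hfin, Set.ncard_coe_finset, Finset.card_filter]
    push_cast
    simp only [mismatch]
    rw [Finset.sum_comm]
    refine Finset.sum_le_sum fun k _ => ?_
    have hnn : ∀ i ∈ Finset.univ, (0 : ℝ) ≤
        if f (T^[k] (y ⟨0, hn⟩)) = f (T^[k] (y i)) then 0 else 1 := fun i _ => by
      split_ifs <;> norm_num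
    split_ifs with hk
    · obtain ⟨i, hi⟩ := hτ (f (T^[k] (y ⟨0, hn⟩)))
      refine le_trans ?_ (Finset.single_le_sum hnn (Finset.mem_univ i))
      rw [if_neg]
      intro heq
      refine Set.disjoint_left.1 hi (hk i) ?_
      rw [hα]
      exact heq.symm
    · exact Finset.sum_nonneg hnn
  rw [lt_div_iff₀ hm0] at h
  have hsum : ∑ _i : Fin n, δ / n * m < ∑ i, mismatch f T m (y ⟨0, hn⟩) (y i) := by
    refine lt_of_eq_of_lt ?_ (h.trans_le hcount)
    simp
    field_simp
  obtain ⟨i, -, hi⟩ := Finset.exists_lt_of_sum_lt hsum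
  exact ⟨i, hi⟩

end Sensitivity

end SeqEntropyTuples

theorem theorem1p1 {X : Type*} [MetricSpace X] [CompactSpace X] [MeasurableSpace X] [BorelSpace X]
    (T : X ≃ₜ X) (μ : MeasureTheory.Measure X) [MeasureTheory.IsProbabilityMeasure μ]
    (hμ : MeasureTheory.MeasurePreserving (T : X → X) μ μ) (n : ℕ) (hn : 2 ≤ n) :
    SeqEntropyTuples.sensitiveInMeanTuples μ T n ⊆
      SeqEntropyTuples.sequenceEntropyTuples μ T hμ.measurable n := by
  rintro x ⟨hx, hsens⟩
  refine ⟨hx, fun l α hadm => ?_⟩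
  obtain ⟨f, hf, hα⟩ := α.exists_measurable_cell_eq
  obtain ⟨τ, hτ0, hτ⟩ : ∃ τ : ℝ, 0 < τ ∧
      ∀ a, ∃ i, Disjoint (Metric.ball (x i) τ) (α.cell a) := by
    choose i hi using hadm
    have hev : ∀ᶠ τ : ℝ in 𝓝[>] 0, ∀ a, Disjoint (Metric.ball (x (i a)) τ) (α.cell a) := by
      refine eventually_all.2 fun a => ?_
      obtain ⟨r, hr, hball⟩ := Metric.mem_nhds_iff.1 (isClosed_closure.isOpen_compl.mem_nhds (hi a))
      filter_upwards [Ioo_mem_nhdsGT hr] with τ hτ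
      refine Set.disjoint_left.2 fun z hz hza => ?_
      exact hball (Metric.ball_subset_ball hτ.2.le hz) (subset_closure hza)
    obtain ⟨τ, hτ, hτ0⟩ := (hev.and self_mem_nhdsWithin).exists
    exact ⟨τ, hτ0, fun a => ⟨i a, hτ a⟩⟩
  obtain ⟨δ, hδ, hA⟩ := hsens τ hτ0
  have hn0 : 0 < n := by omega
  have hn0' : (0 : ℝ) < n := by exact_mod_cast hn0
  refine SeqEntropyTuples.exists_seqEntropy_pos hf hα hμ (ε := δ / n / 2) (by positivity)
    fun A hAm hApos => ?_
  obtain ⟨m, hm, y, hy, hlt⟩ := hA A hAm hApos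
  obtain ⟨i, hi⟩ := SeqEntropyTuples.exists_lt_mismatch hα hn0 hτ hm hlt
  refine ⟨m, hm, y ⟨0, hn0⟩, hy _, y i, hy i, ?_⟩
  rwa [mul_div_cancel₀ _ two_ne_zero]
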